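/- Let $\mathbb D=\{z\in\mathbb C:|z|<1\}$. A holomorphic $g:\mathbb D\to\mathbb C$ is called a generator if for every $z\in\mathbb D$ the Cauchy problem $\frac{\partial u}{\partial t}(t,z)+g(u(t,z))=0$, $u(0,z)=z$, has a unique solution $u(t,z)\in\mathbb D$ for all $t\ge 0$; then $\{u(t,\cdot)\}_{t\ge 0}$ is the semigroup generated by $g$. A number $\kappa>0$ is an exponential squeezing coefficient of this semigroup if $|u(t,z)|\le |z|e^{-\kappa t}$ for all $t>0$, $z\in\mathbb D$. Let $q\in\mathbb C$ with $\Re q>0$, let $r\ge 6/\Re q$, and put $$A(s)=\frac{6s(1+s)}{(1+s)^3-3(5s-1)},\qquad \gamma_r=\frac{1-A(r\Re q)}{1+A(r\Re q)}.$$ Let $F:\mathbb D\to\mathbb C$ be holomorphic with $F(0)=0$, $F'(0)=1+rq$ and $\Re\frac1{2r\Re q}\left(\frac{F(z)}z-(1+rq)\right)>-\frac12$, i.e. $\Re\frac{F(z)}z>1$, for $z\in\mathbb D\setminus\{0\}$ (that is, $F=\mathrm{Id}+rf$, where $f(z)=zp(z)$, $\Re p>0$ and $f'(0)=q$), and let $G_r:\mathbb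 D\to\mathbb D$ be holomorphic with $F(G_r(z))=z$ for all $z\in\mathbb D$, i.e. $G_r=(\mathrm{Id}+rf)^{-1}$ is the nonlinear resolvent of $f$. Then $G_r$ is a generator, and the semigroup $\{u(t,\cdot)\}_{t\ge0}$ generated by $G_r$ has the following properties. (i) $u(t,\cdot)$ converges to $0$ as $t\to\infty$, uniformly on $\mathbb D$. If moreover $|\arg(1+rq)|<\frac{\pi\gamma_r}2$, then $$\kappa(r)=\frac{\left(\Re\,(1+rq)^{1/\gamma_r}\right)^{\gamma_r}}{2^{1-\gamma_r}|1+rq|^2}$$ (principal powers) is positive and is an exponential squeezing coefficient of the semigroup. (ii) For every $z\in\mathbb D$, $u(\cdot,z)$ can be analytically extended, with values in $\mathbb D$, to the sector $S=\left\{t\in\mathbb C\setminus\{0\}: |\arg t-\arg(1+rq)|<\frac{\pi\gamma_r}2\right\}$. Precisely, there are an open convex set $W\supset S\cup(0,\infty)$ and a holomorphic map $W\to\mathbb D$ that equals $u(t,z)$ for every $t\in(0,\infty)$. (If $(0,\infty)\subset S$, this says the same with $W=S$.) -/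

import Mathlib

open Complex Set Filter Topology

noncomputable section

/-- The open unit disk. -/
def unitDisk : Set ℂ := Metric.ball (0 : ℂ) 1

/-- The class of holomorphic functions `F` on the unit disk with `F 0 = 0`, `F' 0 = β` and
`Re ((F z / z - β) / α) > -1/2`. At `z = 0` the quotient `F z / z` stands for `F' 0 = β`, where
the inequality is trivial, so it is required at `z ≠ 0` only. -/
def classA (α β : ℂ) : Set (ℂ → ℂ) :=
  {F | DifferentiableOn ℂ F unitDisk ∧ F 0 = 0 ∧ deriv F 0 = β ∧
    ∀ z ∈ unitDisk, z ≠ 0 → -(1 / 2 : ℝ) < ((1 / α) * (F z / z - β)).re}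

/-- The family of resolvents `G = (id + r f)⁻¹`, with `f 0 = 0` and `f' 0 = q`: the holomorphic
self-mappings `G` of the unit disk that are right inverse to some `F = id + r f` in the class
`classA (2 r Re q) (1 + r q)`. -/
def resolventFamily (q : ℂ) (r : ℝ) : Set (ℂ → ℂ) :=
  {G | DifferentiableOn ℂ G unitDisk ∧ MapsTo G unitDisk unitDisk ∧
    ∃ F ∈ classA ((2 * r * q.re : ℝ) : ℂ) (1 + r * q), ∀ z ∈ unitDisk, F (G z) = z}

/-- `v` solves on `[0, ∞)`, inside the unit disk, the Cauchy problem `v' + f(v) = 0`, `v 0 = z`. -/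
def IsFlowLine (f : ℂ → ℂ) (z : ℂ) (v : ℝ → ℂ) : Prop :=
  v 0 = z ∧ ∀ t : ℝ, 0 ≤ t →
    v t ∈ unitDisk ∧ HasDerivWithinAt v (-(f (v t))) (Ici 0) t

/-- `f` is a generator on the unit disk: it is holomorphic there and the Cauchy problem has a unique
solution in the disk for every initial point and all `t ≥ 0`. -/
def IsGenerator (f : ℂ → ℂ) : Prop :=
  DifferentiableOn ℂ f unitDisk ∧
    ∀ z ∈ unitDisk, ∃ v : ℝ → ℂ, IsFlowLine f z v ∧
      ∀ w : ℝ → ℂ, IsFlowLine f z w → EqOn w v (Ici 0)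

/-- `u` is the semigroup generated by `f` (only its values `u t z` for `t ≥ 0` and `z` in the unit
disk matter). -/
def IsSemigroupGeneratedBy (f : ℂ → ℂ) (u : ℝ → ℂ → ℂ) : Prop :=
  ∀ z ∈ unitDisk, IsFlowLine f z (fun t => u t z)

/-- `κ` is an exponential squeezing coefficient of `u`. -/
def IsSqueezingCoefficient (u : ℝ → ℂ → ℂ) (κ : ℝ) : Prop :=
  0 < κ ∧ ∀ t : ℝ, 0 < t → ∀ z ∈ unitDisk, ‖u t z‖ ≤ ‖z‖ * Real.exp (-κ * t)

/-- The open sector of half-opening `δ` around the direction `φ`, without its vertex. -/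
def sector (φ δ : ℝ) : Set ℂ := {t | t ≠ 0 ∧ |arg t - φ| < δ}

/-- The trajectory `v` extends analytically, with values in the unit disk, from the positive half-axis
to `S`. The common domain `W` of the extension makes the notion meaningful also when `S` does not
contain the half-axis. If `S` is open and convex and contains it, this says exactly that some
holomorphic map from `S` to the disk agrees with `v` on the half-axis. -/
def ExtendsAnalyticallyTo (v : ℝ → ℂ) (S : Set ℂ) : Prop :=
  ∃ W : Set ℂ, IsOpen W ∧ Convex ℝ W ∧ S ⊆ W ∧ (∀ t : ℝ, 0 < t → (t : ℂ) ∈ W) ∧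
    ∃ U : ℂ → ℂ, DifferentiableOn ℂ U W ∧ MapsTo U W unitDisk ∧ ∀ t : ℝ, 0 < t → U t = v t

/-- The function `A(s) = 6 s (1 + s) / ((1 + s)³ - 3 (5 s - 1))`. -/
def funA (s : ℝ) : ℝ := 6 * s * (1 + s) / ((1 + s) ^ 3 - 3 * (5 * s - 1))

/-- The number `γ_r = (1 - A(r Re q)) / (1 + A(r Re q))`. -/
def gammaR (q : ℂ) (r : ℝ) : ℝ := (1 - funA (r * q.re)) / (1 + funA (r * q.re))

/-- The number `κ(r) = (Re (1 + r q)^(1/γ_r))^γ_r / (2^(1 - γ_r) |1 + r q|²)`, with principal powers. -/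
def kappaR (q : ℂ) (r : ℝ) : ℝ :=
  (((1 + r * q) ^ (((1 / gammaR q r : ℝ)) : ℂ) : ℂ).re) ^ (gammaR q r) /
    ((2 : ℝ) ^ (1 - gammaR q r) * ‖1 + r * q‖ ^ 2)

end

/-!
The resolvent factors as `G z = z * g z`, where `1 / g z` is the value of `F w / w` at `w = G z`.
Harnack's inequality and the Schwarz-Pick lemma for the half-plane `1 < re` confine
`(1 + r * q) * g` to the exponentials of a disk of radius `(1 - γ_r) / 2`. Lower bounds for `re g`
turn into exponential decay of the trajectories of `u' = -u * g u`. For the extension to complex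
times, note that all the fields `w ↦ w * (t * g w)` share one Koenigs function `K`, which is
univalent because trajectories tend to `0`, near which `K` is injective. Hence `u t z` extends as
`K⁻¹ (exp (-t * g 0) * K z)` to every complex `t` for which the field `t * G` still points inwards,
that is, for which `re (t * g)` is nonnegative on the disk.
-/

open scoped ComplexConjugate NNReal

section IntegralCurves

variable {E : Type*} [NormedAddCommGroup E] [NormedSpace ℝ E]

theorem exists_hasDerivAt_Ioo_of_lipschitzWith_of_norm_le [CompleteSpace E] {X : E → E} {K C : ℝ≥0}
    (hX : LipschitzWith K X) (hC : ∀ x, ‖X x‖ ≤ C) (x : E) (a : ℝ≥0) :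
    ∃ γ : ℝ → E, γ 0 = x ∧ ∀ t ∈ Ioo (-a : ℝ) a, HasDerivAt γ (X (γ t)) t := by
  have hPL : IsPicardLindelof (fun _ : ℝ => X) (⟨0, by simp⟩ : Icc (-a : ℝ) a) x (C * a) 0 C K :=
    { lipschitzOnWith := fun _ _ => hX.lipschitzOnWith
      continuousOn := fun _ _ => continuousOn_const
      norm_le := fun _ _ y _ => hC y
      mul_max_le := by simp }
  obtain ⟨γ, hγ0, hγ⟩ := hPL.exists_eq_forall_mem_Icc_hasDerivWithinAt₀
  exact ⟨γ, hγ0, fun t ht => (hγ t (Ioo_subset_Icc_self ht)).hasDerivAt (Icc_mem_nhds ht.1 ht.2)⟩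

theorem exists_hasDerivAt_of_lipschitzWith_of_norm_le [CompleteSpace E] {X : E → E} {K C : ℝ≥0}
    (hX : LipschitzWith K X) (hC : ∀ x, ‖X x‖ ≤ C) (x : E) :
    ∃ γ : ℝ → E, γ 0 = x ∧ ∀ t, HasDerivAt γ (X (γ t)) t := by
  choose γ hγ0 hγ using exists_hasDerivAt_Ioo_of_lipschitzWith_of_norm_le hX hC x
  have hmono : ∀ {a b : ℝ≥0}, 0 < a → a ≤ b → EqOn (γ a) (γ b) (Ioo (-a : ℝ) a) := by
    intro a b ha hab
    have hsub : Ioo (-a : ℝ) a ⊆ Ioo (-b : ℝ) b :=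
      Ioo_subset_Ioo (neg_le_neg (by exact_mod_cast hab)) (by exact_mod_cast hab)
    exact ODE_solution_unique_of_mem_Ioo (v := fun _ => X) (s := fun _ => univ) (K := K) (t₀ := 0)
      (fun _ _ => hX.lipschitzOnWith) (by simpa using ha)
      (fun t ht => ⟨hγ a t ht, mem_univ _⟩) (fun t ht => ⟨hγ b t (hsub ht), mem_univ _⟩)
      ((hγ0 a).trans (hγ0 b).symm)
  have hmem : ∀ t : ℝ, t ∈ Ioo (-(‖t‖₊ + 1 : ℝ≥0) : ℝ) (‖t‖₊ + 1 : ℝ≥0) := fun t =>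
    abs_lt.1 (lt_add_one |t|)
  refine ⟨fun t => γ (‖t‖₊ + 1) t, hγ0 _, fun t => (hγ _ t (hmem t)).congr_of_eventuallyEq ?_⟩
  filter_upwards [isOpen_Ioo.mem_nhds (hmem t)] with s hs
  rcases le_total (‖s‖₊ + 1) (‖t‖₊ + 1) with h | h
  · exact hmono (by positivity) h (hmem s)
  · exact (hmono (by positivity) h hs).symm

theorem norm_le_mul_exp_of_inner_le {F : Type*} [NormedAddCommGroup F] [InnerProductSpace ℝ F]
    {v v' : ℝ → F} {κ : ℝ} (hv : ∀ t, 0 ≤ t → HasDerivWithinAt v (v' t) (Ici 0) t)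
    (hκ : ∀ t, 0 ≤ t → inner ℝ (v t) (v' t) ≤ -κ * ‖v t‖ ^ 2) {t : ℝ} (ht : 0 ≤ t) :
    ‖v t‖ ≤ ‖v 0‖ * Real.exp (-κ * t) := by
  set E : ℝ → ℝ := fun x => Real.exp (κ * x) with hE
  have hEderiv : ∀ x, HasDerivAt E (E x * κ) x := fun x => by
    simpa using ((hasDerivAt_id x).const_mul κ).exp
  have hderiv : ∀ x, 0 ≤ x → HasDerivWithinAt (fun x => ‖E x • v x‖ ^ 2)
      (2 * inner ℝ (E x • v x) (E x • v' x + (E x * κ) • v x)) (Ici 0) x := fun x hx =>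
    ((hEderiv x).hasDerivWithinAt.smul (hv x hx)).norm_sq
  have hanti : AntitoneOn (fun x => ‖E x • v x‖ ^ 2) (Ici 0) := by
    refine antitoneOn_of_hasDerivWithinAt_nonpos (convex_Ici 0)
      (fun x hx => (hderiv x hx).continuousWithinAt)
      (fun x hx => (hderiv x (interior_subset hx)).mono interior_subset) fun x hx => ?_
    have hκx := mul_le_mul_of_nonneg_left (hκ x (interior_subset hx)) (sq_nonneg (E x))
    simp only [inner_add_right, real_inner_smul_left, real_inner_smul_right,
      real_inner_self_eq_norm_sq]
    linarith
  have hle : E t * ‖v t‖ ≤ ‖v 0‖ := by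
    have h := (sq_le_sq₀ (norm_nonneg _) (norm_nonneg _)).1 (hanti (mem_Ici.2 le_rfl) ht ht)
    simpa [hE, norm_smul] using h
  rwa [neg_mul, Real.exp_neg, ← div_eq_mul_inv, le_div_iff₀ (Real.exp_pos _), mul_comm]

end IntegralCurves

section UnitDisk

theorem mem_unitDisk {z : ℂ} : z ∈ unitDisk ↔ ‖z‖ < 1 := mem_ball_zero_iff

theorem zero_mem_unitDisk : (0 : ℂ) ∈ unitDisk := Metric.mem_ball_self one_pos

theorem isOpen_unitDisk : IsOpen unitDisk := Metric.isOpen_ball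

theorem unitDisk_mem_nhds {z : ℂ} (hz : z ∈ unitDisk) : unitDisk ∈ 𝓝 z :=
  isOpen_unitDisk.mem_nhds hz

theorem closedBall_norm_subset_unitDisk {z : ℂ} (hz : z ∈ unitDisk) :
    Metric.closedBall 0 ‖z‖ ⊆ unitDisk :=
  Metric.closedBall_subset_ball (mem_unitDisk.1 hz)

end UnitDisk

section Flow

variable {g : ℂ → ℂ} {z : ℂ} {v : ℝ → ℂ} {κ : ℝ}

theorem norm_le_mul_exp_of_le_re {a : ℝ → ℂ}
    (hv : ∀ t, 0 ≤ t → HasDerivWithinAt v (-(v t * a t)) (Ici 0) t)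
    (ha : ∀ t, 0 ≤ t → κ ≤ (a t).re) {t : ℝ} (ht : 0 ≤ t) :
    ‖v t‖ ≤ ‖v 0‖ * Real.exp (-κ * t) := by
  refine norm_le_mul_exp_of_inner_le hv (fun t ht => ?_) ht
  have hinner : inner ℝ (v t) (-(v t * a t)) = -(a t).re * ‖v t‖ ^ 2 := by
    rw [Complex.inner, neg_mul, mul_right_comm, mul_conj, neg_re, Complex.re_ofReal_mul,
      normSq_eq_norm_sq]
    ring
  rw [hinner]
  gcongr
  exact ha t ht

theorem exists_isFlowLine_mul (hg : DifferentiableOn ℂ g unitDisk)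
    (hre : ∀ w ∈ unitDisk, 0 ≤ (g w).re) (hz : z ∈ unitDisk) :
    ∃ v, IsFlowLine (fun w => w * g w) z v := by
  obtain ⟨R, hzR, hR1⟩ := exists_between (mem_unitDisk.1 hz)
  obtain ⟨R', hRR', hR'1⟩ := exists_between hR1
  let φ : ContDiffBump (0 : ℂ) := ⟨R, R', (norm_nonneg z).trans_lt hzR, hRR'⟩
  let X : ℂ → ℂ := fun w => φ w • -(w * g w)
  have hφ : ∀ w, ‖w‖ ≤ ‖z‖ → φ w = 1 := fun w hw =>
    φ.one_of_mem_closedBall (mem_closedBall_zero_iff.2 (hw.trans hzR.le))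
  have hsupp : tsupport X ⊆ unitDisk :=
    (tsupport_smul_subset_left _ _).trans
      (φ.tsupport_eq.trans_subset (Metric.closedBall_subset_ball hR'1))
  have hXc : HasCompactSupport X := φ.hasCompactSupport.smul_right
  have hXd : ContDiff ℝ 1 X := by
    refine contMDiff_iff_contDiff.1 (contMDiff_of_tsupport fun w hw => ?_)
    have hgw : ContDiffAt ℝ 1 g w :=
      (hg.analyticAt (unitDisk_mem_nhds (hsupp hw))).contDiffAt.restrict_scalars ℝ
    exact (φ.contDiff.contDiffAt.smul (contDiffAt_id.mul hgw).neg).contMDiffAt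
  obtain ⟨K, hK⟩ := hXd.lipschitzWith_of_hasCompactSupport hXc one_ne_zero
  obtain ⟨C, hC⟩ := hXc.exists_bound_of_continuous hXd.continuous
  obtain ⟨v, hv0, hv⟩ := exists_hasDerivAt_of_lipschitzWith_of_norm_le hK
    (fun w => (hC w).trans (Real.le_coe_toNNReal C)) z
  have hvz : ∀ t, 0 ≤ t → ‖v t‖ ≤ ‖z‖ := fun t ht => by
    have hv' : ∀ t, 0 ≤ t → HasDerivWithinAt v (-(v t * (φ (v t) • g (v t)))) (Ici 0) t :=
      fun t _ => by simpa only [X, smul_neg, mul_smul_comm] using (hv t).hasDerivWithinAt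
    have hre' : ∀ t, 0 ≤ t → 0 ≤ (φ (v t) • g (v t)).re := fun t _ => by
      rw [real_smul, Complex.re_ofReal_mul]
      by_cases hvt : v t ∈ unitDisk
      · exact mul_nonneg φ.nonneg (hre _ hvt)
      · rw [φ.zero_of_le_dist (hR'1.le.trans (by simpa [mem_unitDisk] using hvt)), zero_mul]
    simpa [hv0] using norm_le_mul_exp_of_le_re hv' hre' ht
  refine ⟨v, hv0, fun t ht => ⟨mem_unitDisk.2 ((hvz t ht).trans_lt (mem_unitDisk.1 hz)), ?_⟩⟩
  simpa [X, hφ _ (hvz t ht)] using (hv t).hasDerivWithinAt (s := Ici 0)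

theorem IsFlowLine.norm_le (hv : IsFlowLine (fun w => w * g w) z v)
    (hκ : ∀ t, 0 ≤ t → κ ≤ (g (v t)).re) {t : ℝ} (ht : 0 ≤ t) :
    ‖v t‖ ≤ ‖z‖ * Real.exp (-κ * t) := by
  simpa only [hv.1] using norm_le_mul_exp_of_le_re (fun t ht => (hv.2 t ht).2) hκ ht

theorem tendsto_exp_neg_mul_atTop (hκ : 0 < κ) :
    Tendsto (fun t => Real.exp (-κ * t)) atTop (𝓝 0) :=
  Real.tendsto_exp_atBot.comp (tendsto_id.const_mul_atTop_of_neg (neg_lt_zero.2 hκ))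

theorem IsFlowLine.tendsto_zero (hg : ContinuousOn g unitDisk)
    (hre : ∀ w ∈ unitDisk, 0 < (g w).re) (hz : z ∈ unitDisk)
    (hv : IsFlowLine (fun w => w * g w) z v) : Tendsto v atTop (𝓝 0) := by
  obtain ⟨w₀, hw₀, hmin⟩ := (isCompact_closedBall (0 : ℂ) ‖z‖).exists_isMinOn
    (Metric.nonempty_closedBall.2 (norm_nonneg z))
    (continuous_re.comp_continuousOn (hg.mono (closedBall_norm_subset_unitDisk hz)))
  have hvz : ∀ t, 0 ≤ t → v t ∈ Metric.closedBall 0 ‖z‖ := fun t ht => by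
    simpa using hv.norm_le (κ := 0) (fun t ht => (hre _ (hv.2 t ht).1).le) ht
  have hlim := (tendsto_exp_neg_mul_atTop
    (hre w₀ (closedBall_norm_subset_unitDisk hz hw₀))).const_mul ‖z‖
  rw [mul_zero] at hlim
  refine squeeze_zero_norm' ?_ hlim
  filter_upwards [eventually_ge_atTop 0] with t ht
    using hv.norm_le (fun t ht => isMinOn_iff.1 hmin _ (hvz t ht)) ht

theorem isSqueezingCoefficient_of_le_re {u : ℝ → ℂ → ℂ} (hκ0 : 0 < κ)
    (hκ : ∀ w ∈ unitDisk, κ ≤ (g w).re) (hu : IsSemigroupGeneratedBy (fun w => w * g w) u) :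
    IsSqueezingCoefficient u κ :=
  ⟨hκ0, fun _ ht z hz => (hu z hz).norm_le (fun t ht => hκ _ ((hu z hz).2 t ht).1) ht.le⟩

theorem IsSqueezingCoefficient.tendstoUniformlyOn {u : ℝ → ℂ → ℂ}
    (hu : IsSqueezingCoefficient u κ) : TendstoUniformlyOn u (fun _ => 0) atTop unitDisk := by
  rw [Metric.tendstoUniformlyOn_iff]
  intro ε hε
  filter_upwards [(tendsto_exp_neg_mul_atTop hu.1).eventually_lt_const hε, eventually_gt_atTop 0]
    with t htε ht z hz
  rw [dist_zero_left]
  calc ‖u t z‖ ≤ ‖z‖ * Real.exp (-κ * t) := hu.2 t ht z hz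
    _ ≤ Real.exp (-κ * t) := mul_le_of_le_one_left (Real.exp_pos _).le (mem_unitDisk.1 hz).le
    _ < ε := htε

end Flow

section Koenigs

/-- `K` is a Koenigs function of the field `w ↦ w * g w` on the unit disk: it is holomorphic without
critical points and linearizes the field, in the sense of Schröder's equation. Multiplying `g` by a
nonzero constant does not change its Koenigs functions. -/
structure IsKoenigsFunction (g K : ℂ → ℂ) : Prop where
  differentiableOn : DifferentiableOn ℂ K unitDisk
  deriv_ne_zero : ∀ z ∈ unitDisk, deriv K z ≠ 0
  deriv_mul : ∀ z ∈ unitDisk, deriv K z * (z * g z) = g 0 * K z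

variable {g K : ℂ → ℂ} {z : ℂ} {v w : ℝ → ℂ}

theorem exists_isKoenigsFunction (hg : DifferentiableOn ℂ g unitDisk)
    (hg0 : ∀ z ∈ unitDisk, g z ≠ 0) : ∃ K, IsKoenigsFunction g K := by
  obtain ⟨h, hh⟩ := DifferentiableOn.isExactOn_ball (c := 0) (r := 1)
    ((differentiableOn_dslope (unitDisk_mem_nhds zero_mem_unitDisk)).2
      ((differentiableOn_const (g 0)).div hg hg0))
  have hderiv : ∀ z ∈ unitDisk,
      HasDerivAt (fun z => z * exp (h z)) (exp (h z) * (g 0 / g z)) z := fun z hz => by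
    have hquot := sub_smul_dslope (fun w => g 0 / g w) 0 z
    rw [div_self (hg0 0 zero_mem_unitDisk), smul_eq_mul, sub_zero] at hquot
    refine ((hasDerivAt_id' z).mul (hh z hz).cexp).congr_deriv ?_
    linear_combination exp (h z) * hquot
  refine ⟨fun z => z * exp (h z), fun z hz => ?_, fun z hz => ?_, fun z hz => ?_⟩
  · exact (hderiv z hz).differentiableAt.differentiableWithinAt
  · rw [(hderiv z hz).deriv]
    exact mul_ne_zero (exp_ne_zero _) (div_ne_zero (hg0 0 zero_mem_unitDisk) (hg0 z hz))
  · rw [(hderiv z hz).deriv]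
    have := hg0 z hz
    field_simp

namespace IsKoenigsFunction

theorem const_mul (hK : IsKoenigsFunction g K) (t : ℂ) :
    IsKoenigsFunction (fun z => t * g z) K where
  differentiableOn := hK.differentiableOn
  deriv_ne_zero := hK.deriv_ne_zero
  deriv_mul z hz := by linear_combination t * hK.deriv_mul z hz

theorem hasStrictDerivAt (hK : IsKoenigsFunction g K) (hz : z ∈ unitDisk) :
    HasStrictDerivAt K (deriv K z) z :=
  (hK.differentiableOn.analyticAt (unitDisk_mem_nhds hz)).hasStrictDerivAt

theorem comp_isFlowLine (hK : IsKoenigsFunction g K) (hv : IsFlowLine (fun w => w * g w) z v)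
    {t : ℝ} (ht : 0 ≤ t) : K (v t) = exp (-(t * g 0)) * K z := by
  have hderiv : ∀ s, 0 ≤ s →
      HasDerivWithinAt (fun s : ℝ => exp (s * g 0) * K (v s)) 0 (Ici 0) s := fun s hs => by
    obtain ⟨hvs, hvs'⟩ := hv.2 s hs
    have hexp : HasDerivAt (fun s : ℝ => exp (s * g 0)) (exp (s * g 0) * (1 * g 0)) s :=
      ((hasDerivAt_id s).ofReal_comp.mul_const (g 0)).cexp
    refine (hexp.hasDerivWithinAt.mul
      ((hK.hasStrictDerivAt hvs).hasDerivAt.comp_hasDerivWithinAt s hvs')).congr_deriv ?_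
    simp only [Function.comp_apply]
    linear_combination -exp (s * g 0) * hK.deriv_mul _ hvs
  have hconst := constant_of_has_deriv_right_zero
    (fun s hs => ((hderiv s hs.1).continuousWithinAt).mono Icc_subset_Ici_self)
    (fun s hs => (hderiv s hs.1).mono (Ici_subset_Ici.2 hs.1)) t ⟨ht, le_rfl⟩
  simp only [ofReal_zero, zero_mul, exp_zero, one_mul, hv.1] at hconst
  rw [← hconst, exp_neg, inv_mul_cancel_left₀ (exp_ne_zero _)]

theorem exists_nhds_injOn (hK : IsKoenigsFunction g K) (hz : z ∈ unitDisk) :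
    ∃ U ∈ 𝓝 z, InjOn K U :=
  ⟨_, (hK.hasStrictDerivAt hz).eventually_left_inverse (hK.deriv_ne_zero z hz),
    fun _ ha _ hb hab => ha.symm.trans ((congrArg _ hab).trans hb)⟩

theorem isLocallyInjective_domRestrict (hK : IsKoenigsFunction g K) :
    IsLocallyInjective (unitDisk.domRestrict K) := by
  refine isLocallyInjective_iff_nhds.2 fun z => ?_
  obtain ⟨U, hU, hinj⟩ := hK.exists_nhds_injOn z.2
  exact ⟨_, continuous_subtype_val.continuousAt.preimage_mem_nhds hU,
    fun a ha b hb hab => Subtype.ext (hinj ha hb hab)⟩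

theorem eqOn_of_comp_eqOn (hK : IsKoenigsFunction g K) {A : Type*} [TopologicalSpace A] {s : Set A}
    (hs : IsPreconnected s) {φ ψ : A → ℂ} (hφ : ContinuousOn φ s) (hψ : ContinuousOn ψ s)
    (hφm : MapsTo φ s unitDisk) (hψm : MapsTo ψ s unitDisk) (hcomp : EqOn (K ∘ φ) (K ∘ ψ) s)
    {a : A} (ha : a ∈ s) (hae : φ a = ψ a) : EqOn φ ψ s := fun x hx => by
  have : PreconnectedSpace s := Subtype.preconnectedSpace hs
  have heq : hφm.restrict = hψm.restrict :=
    (T2Space.isSeparatedMap _).eq_of_comp_eq hK.isLocallyInjective_domRestrict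
      (hφ.mapsToRestrict hφm) (hψ.mapsToRestrict hψm) (funext fun y => hcomp y.2) ⟨a, ha⟩
      (Subtype.ext hae)
  exact congrArg Subtype.val (congrFun heq ⟨x, hx⟩)

/- Any two flow lines end up in a neighbourhood of `0` on which `K` is injective; local injectivity
carries their coincidence back to time `0`. -/
theorem injOn (hK : IsKoenigsFunction g K) (hg : DifferentiableOn ℂ g unitDisk)
    (hre : ∀ w ∈ unitDisk, 0 < (g w).re) : InjOn K unitDisk := by
  intro a ha b hb hab
  obtain ⟨v, hv⟩ := exists_isFlowLine_mul hg (fun w hw => (hre w hw).le) ha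
  obtain ⟨w, hw⟩ := exists_isFlowLine_mul hg (fun w hw => (hre w hw).le) hb
  have hcomp : ∀ t, 0 ≤ t → K (v t) = K (w t) := fun t ht => by
    rw [hK.comp_isFlowLine hv ht, hK.comp_isFlowLine hw ht, hab]
  obtain ⟨U, hU, hinj⟩ := hK.exists_nhds_injOn zero_mem_unitDisk
  obtain ⟨T, hT, hvT, hwT⟩ := ((eventually_ge_atTop 0).and
    (((hv.tendsto_zero hg.continuousOn hre ha).eventually_mem hU).and
      ((hw.tendsto_zero hg.continuousOn hre hb).eventually_mem hU))).exists
  have heq : EqOn v w (Ici 0) := hK.eqOn_of_comp_eqOn isPreconnected_Ici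
    (fun t ht => (hv.2 t ht).2.continuousWithinAt) (fun t ht => (hw.2 t ht).2.continuousWithinAt)
    (fun t ht => (hv.2 t ht).1) (fun t ht => (hw.2 t ht).1) hcomp hT (hinj hvT hwT (hcomp T hT))
  rw [← hv.1, ← hw.1, heq (mem_Ici.2 le_rfl)]

theorem differentiableOn_invFunOn (hK : IsKoenigsFunction g K) (hinj : InjOn K unitDisk) :
    DifferentiableOn ℂ (Function.invFunOn K unitDisk) (K '' unitDisk) := by
  rintro _ ⟨z, hz, rfl⟩
  have hleft : ∀ᶠ w in 𝓝 z, Function.invFunOn K unitDisk (K w) = w :=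
    mem_of_superset (unitDisk_mem_nhds hz) hinj.leftInvOn_invFunOn
  exact ((hK.hasStrictDerivAt hz).to_local_left_inverse (hK.deriv_ne_zero z hz)
    hleft).hasDerivAt.differentiableAt.differentiableWithinAt

end IsKoenigsFunction

theorem exists_isKoenigsFunction_injOn (hg : DifferentiableOn ℂ g unitDisk)
    (hre : ∀ w ∈ unitDisk, 0 < (g w).re) : ∃ K, IsKoenigsFunction g K ∧ InjOn K unitDisk := by
  obtain ⟨K, hK⟩ := exists_isKoenigsFunction hg fun w hw h0 => (hre w hw).ne' (by rw [h0, zero_re])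
  exact ⟨K, hK, hK.injOn hg hre⟩

theorem isGenerator_mul_of_re_pos (hg : DifferentiableOn ℂ g unitDisk)
    (hre : ∀ w ∈ unitDisk, 0 < (g w).re) : IsGenerator (fun w => w * g w) := by
  obtain ⟨K, hK, hinj⟩ := exists_isKoenigsFunction_injOn hg hre
  refine ⟨differentiableOn_id.mul hg, fun z hz => ?_⟩
  obtain ⟨v, hv⟩ := exists_isFlowLine_mul hg (fun w hw => (hre w hw).le) hz
  refine ⟨v, hv, fun w hw t ht => hinj (hw.2 t ht).1 (hv.2 t ht).1 ?_⟩
  rw [hK.comp_isFlowLine hw ht, hK.comp_isFlowLine hv ht]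

end Koenigs

section AccretiveTimes

variable {g : ℂ → ℂ}

/-- The complex times `t` for which the field `w ↦ w * (t * g w)` still contracts the unit disk
towards `0`. -/
def accretiveTimes (g : ℂ → ℂ) : Set ℂ := {t | ∀ z ∈ unitDisk, 0 ≤ (t * g z).re}

theorem convex_accretiveTimes (g : ℂ → ℂ) : Convex ℝ (accretiveTimes g) := by
  intro s hs t ht a b ha hb _ z hz
  have hsum : ((a • s + b • t) * g z).re = a * (s * g z).re + b * (t * g z).re := by
    simp only [real_smul, add_mul, mul_assoc, add_re, Complex.re_ofReal_mul]
  rw [hsum]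
  exact add_nonneg (mul_nonneg ha (hs z hz)) (mul_nonneg hb (ht z hz))

theorem mem_interior_accretiveTimes {B ε : ℝ} {t : ℂ} (hB : ∀ z ∈ unitDisk, ‖g z‖ ≤ B) (hε : 0 < ε)
    (ht : ∀ z ∈ unitDisk, ε ≤ (t * g z).re) : t ∈ interior (accretiveTimes g) := by
  have hB0 : 0 ≤ B := (norm_nonneg _).trans (hB 0 zero_mem_unitDisk)
  refine mem_interior_iff_mem_nhds.2 (Metric.mem_nhds_iff.2
    ⟨ε / (B + 1), by positivity, fun s hs z hz => ?_⟩)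
  rw [Metric.mem_ball, dist_eq_norm, lt_div_iff₀ (by positivity)] at hs
  have hdiff : |((s - t) * g z).re| ≤ ε :=
    calc |((s - t) * g z).re| ≤ ‖s - t‖ * ‖g z‖ := (abs_re_le_norm _).trans (norm_mul_le _ _)
      _ ≤ ‖s - t‖ * (B + 1) := by gcongr; linarith [hB z hz]
      _ ≤ ε := hs.le
  rw [sub_mul, sub_re] at hdiff
  linarith [ht z hz, (abs_le.1 hdiff).1]

theorem IsFlowLine.extendsAnalyticallyTo {z : ℂ} {v : ℝ → ℂ}
    (hv : IsFlowLine (fun w => w * g w) z v) (hz : z ∈ unitDisk)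
    (hg : DifferentiableOn ℂ g unitDisk) (hre : ∀ w ∈ unitDisk, 0 < (g w).re)
    (hpos : ∀ t : ℝ, 0 < t → (t : ℂ) ∈ interior (accretiveTimes g)) {S : Set ℂ}
    (hS : S ⊆ interior (accretiveTimes g)) : ExtendsAnalyticallyTo v S := by
  obtain ⟨K, hK, hinj⟩ := exists_isKoenigsFunction_injOn hg hre
  have himage : MapsTo (fun t => exp (-(t * g 0)) * K z) (interior (accretiveTimes g))
      (K '' unitDisk) := fun t ht => by
    obtain ⟨w, hw⟩ := exists_isFlowLine_mul (hg.const_mul t) (interior_subset ht) hz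
    refine ⟨w 1, (hw.2 1 zero_le_one).1, ?_⟩
    simpa using (hK.const_mul t).comp_isFlowLine hw zero_le_one
  refine ⟨interior (accretiveTimes g), isOpen_interior, (convex_accretiveTimes g).interior, hS,
    hpos, fun t => Function.invFunOn K unitDisk (exp (-(t * g 0)) * K z), ?_, fun t ht => ?_,
    fun t ht => ?_⟩
  · exact (hK.differentiableOn_invFunOn hinj).comp (by fun_prop) himage
  · exact Function.invFunOn_mem (himage ht)
  · simp only [← hK.comp_isFlowLine hv ht.le]
    exact hinj.leftInvOn_invFunOn (hv.2 t ht.le).1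

end AccretiveTimes

section HalfPlane

theorem norm_sub_le_norm_add_conj {a b : ℂ} (ha : 0 ≤ a.re) (hb : 0 ≤ b.re) :
    ‖a - b‖ ≤ ‖a + conj b‖ := by
  refine le_of_sq_le_sq ?_ (norm_nonneg _)
  simp only [Complex.sq_norm, normSq_apply, sub_re, sub_im, add_re, add_im, conj_re, conj_im]
  nlinarith [mul_nonneg ha hb]

theorem add_conj_ne_zero {a b : ℂ} (ha : 0 < a.re) (hb : 0 < b.re) : a + conj b ≠ 0 := fun h => by
  have hre := congrArg Complex.re h
  simp only [add_re, conj_re, zero_re] at hre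
  linarith

theorem norm_sub_div_add_conj_le {P : ℂ → ℂ} (hP : DifferentiableOn ℂ P unitDisk)
    (hre : ∀ w ∈ unitDisk, 0 < (P w).re) {w : ℂ} (hw : w ∈ unitDisk) :
    ‖(P w - P 0) / (P w + conj (P 0))‖ ≤ ‖w‖ := by
  have h0 := hre 0 zero_mem_unitDisk
  refine norm_le_norm_of_mapsTo_ball (f := fun w => (P w - P 0) / (P w + conj (P 0))) (R := 1)
    ((hP.sub_const _).div (hP.add_const _) fun x hx => add_conj_ne_zero (hre x hx) h0) ?_
    (by simp) (mem_unitDisk.1 hw)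
  intro x hx
  rw [mem_closedBall_zero_iff, norm_div]
  exact div_le_one_of_le₀ (norm_sub_le_norm_add_conj (hre x hx).le h0.le) (norm_nonneg _)

theorem re_mul_one_sub_le_of_norm_sub_le {a b : ℂ} {x : ℝ} (ha : 0 ≤ a.re) (hb : 0 ≤ b.re)
    (hx0 : 0 ≤ x) (hx1 : x ≤ 1) (h : ‖a - b‖ ≤ x * ‖a + conj b‖) :
    b.re * (1 - x) ≤ a.re * (1 + x) := by
  have hsq := pow_le_pow_left₀ (norm_nonneg _) h 2
  simp only [mul_pow, Complex.sq_norm, normSq_apply, sub_re, sub_im, add_re, add_im, conj_re,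
    conj_im] at hsq
  have hre : (b.re - a.re) ^ 2 ≤ (x * (a.re + b.re)) ^ 2 := by
    nlinarith [mul_nonneg (sub_nonneg.2 (pow_le_one₀ hx0 hx1 : x ^ 2 ≤ 1))
      (mul_self_nonneg (a.im - b.im))]
  linarith [(abs_le.1 (abs_le_of_sq_le_sq hre (by positivity))).2]

theorem harnack_re_mul_le {P : ℂ → ℂ} (hP : DifferentiableOn ℂ P unitDisk)
    (hre : ∀ w ∈ unitDisk, 0 < (P w).re) {w : ℂ} (hw : w ∈ unitDisk) :
    (P 0).re * (1 - ‖w‖) ≤ (P w).re * (1 + ‖w‖) := by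
  have h0 := hre 0 zero_mem_unitDisk
  refine re_mul_one_sub_le_of_norm_sub_le (hre w hw).le h0.le (norm_nonneg w)
    (mem_unitDisk.1 hw).le ?_
  have hschwarz := norm_sub_div_add_conj_le hP hre hw
  rwa [norm_div, div_le_iff₀ (norm_pos_iff.2 (add_conj_ne_zero (hre w hw) h0))] at hschwarz

variable {Q : ℂ → ℂ} {w : ℂ}

theorem norm_mul_re_sub_two_lt_one (hQ : DifferentiableOn ℂ Q unitDisk)
    (hre : ∀ w ∈ unitDisk, 1 < (Q w).re) (hw : w ∈ unitDisk) (hwQ : ‖w * Q w‖ < 1) :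
    ‖w‖ * ((Q 0).re - 2) < 1 := by
  have hharnack := harnack_re_mul_le (hQ.sub_const 1)
    (fun x hx => by simpa using hre x hx) hw
  simp only [sub_re, one_re] at hharnack
  have hwre : ‖w‖ * (Q w).re < 1 :=
    (mul_le_mul_of_nonneg_left (re_le_norm (Q w)) (norm_nonneg w)).trans_lt (by rwa [← norm_mul])
  have hw1 := mem_unitDisk.1 hw
  nlinarith [mul_le_mul_of_nonneg_left hharnack (norm_nonneg w), norm_nonneg w]

theorem exists_exp_eq_div_of_norm_le {M u : ℂ} {x : ℝ} (hx : x < 1) (hM : ‖M‖ ≤ x) (hu : ‖u‖ ≤ 1) :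
    ∃ W : ℂ, exp W = (1 - M) / (1 + u * M) ∧ ‖W‖ ≤ 2 * (x ^ 2 * (1 - x)⁻¹ / 2 + x) := by
  have hlog : ∀ a : ℂ, ‖a‖ ≤ x → exp (log (1 + a)) = 1 + a ∧
      ‖log (1 + a)‖ ≤ x ^ 2 * (1 - x)⁻¹ / 2 + x := fun a ha => by
    have hne : 1 + a ≠ 0 := slitPlane_ne_zero (mem_slitPlane_of_norm_lt_one (ha.trans_lt hx))
    refine ⟨exp_log hne, (norm_log_one_add_le (ha.trans_lt hx)).trans ?_⟩
    have : 0 ≤ (1 - ‖a‖)⁻¹ := inv_nonneg.2 (by linarith)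
    have : 0 < 1 - x := by linarith
    gcongr
  obtain ⟨hexp₁, hle₁⟩ := hlog (-M) (by rwa [norm_neg])
  obtain ⟨hexp₂, hle₂⟩ := hlog (u * M)
    ((norm_mul_le _ _).trans ((mul_le_of_le_one_left (norm_nonneg _) hu).trans hM))
  refine ⟨log (1 + -M) - log (1 + u * M), by rw [exp_sub, hexp₁, hexp₂, ← sub_eq_add_neg], ?_⟩
  linarith [norm_sub_le (log (1 + -M)) (log (1 + u * M))]

theorem norm_conj_sub_two_div_le_one {β : ℂ} (hβ : 1 ≤ β.re) : ‖(conj β - 2) / β‖ ≤ 1 := by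
  rw [norm_div]
  refine div_le_one_of_le₀ (le_of_sq_le_sq ?_ (norm_nonneg _)) (norm_nonneg _)
  simp only [Complex.sq_norm, normSq_apply, sub_re, sub_im, conj_re, conj_im, re_ofNat, im_ofNat]
  nlinarith

/- Solving `M = (Q w - Q 0) / (Q w + conj (Q 0) - 2)` for `Q w` gives
`Q w * (1 - M) = Q 0 * (1 + u * M)`, where `u = (conj (Q 0) - 2) / Q 0`. -/
theorem exists_inv_eq_exp_div (hQ : DifferentiableOn ℂ Q unitDisk)
    (hre : ∀ w ∈ unitDisk, 1 < (Q w).re) (hw : w ∈ unitDisk) :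
    ∃ W : ℂ, ‖W‖ ≤ 2 * (‖w‖ ^ 2 * (1 - ‖w‖)⁻¹ / 2 + ‖w‖) ∧ (Q w)⁻¹ = exp W / Q 0 := by
  have hre' : ∀ x ∈ unitDisk, 0 < (Q x - 1).re := fun x hx => by simpa using hre x hx
  have h0 := hre 0 zero_mem_unitDisk
  have hM := norm_sub_div_add_conj_le (hQ.sub_const 1) hre' hw
  set M := (Q w - 1 - (Q 0 - 1)) / (Q w - 1 + conj (Q 0 - 1))
  set u := (conj (Q 0) - 2) / Q 0
  obtain ⟨W, hW, hWle⟩ := exists_exp_eq_div_of_norm_le (mem_unitDisk.1 hw) hM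
    (norm_conj_sub_two_div_le_one h0.le)
  refine ⟨W, hWle, ?_⟩
  have hMmul : M * (Q w - 1 + conj (Q 0 - 1)) = Q w - 1 - (Q 0 - 1) :=
    div_mul_cancel₀ _ (add_conj_ne_zero (hre' w hw) (hre' 0 zero_mem_unitDisk))
  have hQ0 : Q 0 ≠ 0 := fun h => by simp only [h, zero_re] at h0; linarith
  have hQw : Q w ≠ 0 := fun h => by have := hre w hw; simp only [h, zero_re] at this; linarith
  have huM : 1 + u * M ≠ 0 := by
    refine slitPlane_ne_zero (mem_slitPlane_of_norm_lt_one ?_)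
    calc ‖u * M‖ ≤ 1 * ‖w‖ := (norm_mul_le _ _).trans
          (mul_le_mul (norm_conj_sub_two_div_le_one h0.le) hM (norm_nonneg _) zero_le_one)
      _ < 1 := by simpa using mem_unitDisk.1 hw
  have hsolve : Q w * (1 - M) = Q 0 * (1 + u * M) := by
    have hu : Q 0 * u = conj (Q 0) - 2 := mul_div_cancel₀ _ hQ0
    rw [map_sub, map_one] at hMmul
    linear_combination -hMmul - M * hu
  rw [hW, div_div, inv_eq_one_div, div_eq_div_iff hQw (mul_ne_zero huM hQ0)]
  linear_combination -hsolve

end HalfPlane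

section Constants

theorem funA_denom_pos {s : ℝ} (hs : 6 ≤ s) : 0 < (1 + s) ^ 3 - 3 * (5 * s - 1) := by
  nlinarith [mul_nonneg (by linarith : 0 ≤ s) (sq_nonneg s)]

theorem funA_mem_Ioo {s : ℝ} (hs : 6 ≤ s) : funA s ∈ Ioo 0 1 := by
  have hs6 : 0 ≤ s - 6 := sub_nonneg.2 hs
  refine ⟨div_pos (by positivity) (funA_denom_pos hs), (div_lt_one (funA_denom_pos hs)).2 ?_⟩
  have hdiff : (1 + s) ^ 3 - 3 * (5 * s - 1) - 6 * s * (1 + s) =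
      (s - 6) ^ 3 + 15 * (s - 6) ^ 2 + 54 * (s - 6) + 4 := by ring
  exact sub_pos.1 (hdiff ▸ by positivity)

theorem gammaR_mem_Ioo {q : ℂ} {r : ℝ} (hs : 6 ≤ r * q.re) : gammaR q r ∈ Ioo 0 1 := by
  obtain ⟨h0, h1⟩ := funA_mem_Ioo hs
  exact ⟨div_pos (by linarith) (by linarith), (div_lt_one (by linarith)).2 (by linarith)⟩

theorem one_sub_gammaR_div_two {q : ℂ} {r : ℝ} (hs : 6 ≤ r * q.re) :
    (1 - gammaR q r) / 2 = funA (r * q.re) / (1 + funA (r * q.re)) := by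
  have hA : 1 + funA (r * q.re) ≠ 0 := by linarith [(funA_mem_Ioo hs).1]
  unfold gammaR
  field_simp
  ring

theorem le_funA_div_one_add_funA {s : ℝ} (hs : 6 ≤ s) :
    (2 * s - 3) / ((s - 1) * (s - 2)) ≤ funA s / (1 + funA s) := by
  have hs6 : 0 ≤ s - 6 := sub_nonneg.2 hs
  have hD := funA_denom_pos hs
  have hN : 0 < 6 * s * (1 + s) := by positivity
  have hfun : funA s / (1 + funA s) =
      6 * s * (1 + s) / ((1 + s) ^ 3 - 3 * (5 * s - 1) + 6 * s * (1 + s)) := by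
    rw [funA, one_add_div hD.ne', div_div_div_cancel_right₀ hD.ne']
  have hdiff : 6 * s * (1 + s) * ((s - 1) * (s - 2)) -
      (2 * s - 3) * ((1 + s) ^ 3 - 3 * (5 * s - 1) + 6 * s * (1 + s)) =
      4 * (s - 6) ^ 4 + 69 * (s - 6) ^ 3 + 411 * (s - 6) ^ 2 + 922 * (s - 6) + 468 := by ring
  have h12 : 0 < (s - 1) * (s - 2) := mul_pos (by linarith) (by linarith)
  rw [hfun, div_le_div_iff₀ h12 (by positivity)]
  exact sub_nonneg.1 (hdiff ▸ by positivity)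

theorem log_bound_le_one_sub_gammaR_div_two {q : ℂ} {r x : ℝ} (hs : 6 ≤ r * q.re) (hx0 : 0 ≤ x)
    (hx : x * (r * q.re - 1) < 1) :
    2 * (x ^ 2 * (1 - x)⁻¹ / 2 + x) ≤ (1 - gammaR q r) / 2 := by
  rw [one_sub_gammaR_div_two hs]
  set s := r * q.re
  have h1 : 0 < s - 1 := by linarith
  have h2 : 0 < s - 2 := by linarith
  have hxle : x ≤ 1 / (s - 1) := ((lt_div_iff₀ h1).2 hx).le
  have hsub : 1 - 1 / (s - 1) = (s - 2) / (s - 1) := by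
    field_simp
    ring
  have hpos : 0 < 1 - 1 / (s - 1) := hsub ▸ div_pos h2 h1
  have hinv : 0 ≤ (1 - x)⁻¹ := inv_nonneg.2 (by linarith)
  calc 2 * (x ^ 2 * (1 - x)⁻¹ / 2 + x)
      ≤ 2 * ((1 / (s - 1)) ^ 2 * (1 - 1 / (s - 1))⁻¹ / 2 + 1 / (s - 1)) := by gcongr
    _ = (2 * s - 3) / ((s - 1) * (s - 2)) := by
      rw [hsub]
      field_simp
      ring
    _ ≤ funA s / (1 + funA s) := le_funA_div_one_add_funA hs

end Constants

section ExpBounds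

variable {β t V : ℂ} {γ : ℝ}

theorem cos_rpow_mul_cos_rpow_le {a b : ℝ} (hγ0 : 0 ≤ γ) (hγ1 : γ ≤ 1)
    (ha : |a| ≤ Real.pi / 2) (hb : |b| ≤ Real.pi / 2) :
    Real.cos a ^ γ * Real.cos b ^ (1 - γ) ≤ Real.cos (γ * a + (1 - γ) * b) :=
  (Real.geom_mean_le_arith_mean2_weighted hγ0 (sub_nonneg.2 hγ1)
    (Real.cos_nonneg_of_mem_Icc (abs_le.1 ha)) (Real.cos_nonneg_of_mem_Icc (abs_le.1 hb))
    (by ring)).trans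
  (strictConcaveOn_cos_Icc.concaveOn.2 (abs_le.1 ha) (abs_le.1 hb) hγ0 (sub_nonneg.2 hγ1) (by ring))

theorem half_le_exp_re_mul_cos_im (hV : ‖V‖ ≤ 1 / 2) :
    1 / 2 ≤ Real.exp V.re * Real.cos V.im := by
  have hsq : V.re ^ 2 + V.im ^ 2 ≤ 1 / 4 := by
    have h := pow_le_pow_left₀ (norm_nonneg _) hV 2
    rw [Complex.sq_norm, normSq_apply] at h
    linarith
  have hre : -(1 / 2) ≤ V.re := by nlinarith [sq_nonneg V.im]
  have him : 0 ≤ 1 - V.im ^ 2 / 2 := by nlinarith [sq_nonneg V.re]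
  calc (1 / 2 : ℝ) ≤ (V.re + 1) * (1 - V.im ^ 2 / 2) := by
        nlinarith [mul_nonneg (by linarith : 0 ≤ V.re + 1) (sub_nonneg.2 hsq),
          mul_nonneg (by linarith : 0 ≤ V.re + 1 / 2) (sq_nonneg V.re)]
    _ ≤ Real.exp V.re * Real.cos V.im :=
        mul_le_mul (Real.add_one_le_exp _) Real.one_sub_sq_div_two_le_cos him (Real.exp_pos _).le

theorem re_mul_exp_div (t W β : ℂ) :
    (t * (exp W / β)).re =
      ‖t‖ / ‖β‖ * (Real.exp W.re * Real.cos (W.im + (arg t - arg β))) := by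
  have hpolar : t * (exp W / β) =
      ((‖t‖ / ‖β‖ : ℝ) : ℂ) * exp (W + ((arg t - arg β : ℝ) : ℂ) * I) := by
    conv_lhs => rw [← norm_mul_exp_arg_mul_I t, ← norm_mul_exp_arg_mul_I β]
    push_cast
    rw [sub_mul, exp_add, exp_sub]
    ring
  rw [hpolar, Complex.re_ofReal_mul, exp_re]
  simp

theorem re_exp_div (W β : ℂ) :
    (exp W / β).re = ‖β‖⁻¹ * (Real.exp W.re * Real.cos (W.im - arg β)) := by
  simpa [sub_eq_add_neg] using re_mul_exp_div 1 W β

theorem abs_arg_div_lt (hγ : 0 < γ) (hβ : |arg β| < Real.pi * γ / 2) :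
    |arg β / γ| < Real.pi / 2 := by
  rw [abs_div, abs_of_pos hγ, div_lt_iff₀ hγ]
  linarith

theorem cos_arg_div_rpow_mul_le_re_exp_div (hγ0 : 0 < γ) (hγ1 : γ ≤ 1)
    (hβ : |arg β| < Real.pi * γ / 2) (hV : ‖V‖ ≤ 1 / 2) :
    ‖β‖⁻¹ * (Real.cos (arg β / γ) ^ γ * (1 / 2) ^ (1 - γ)) ≤ (exp ((1 - γ : ℝ) * V) / β).re := by
  have hVim : |V.im| ≤ Real.pi / 2 := by
    linarith [(abs_im_le_norm V).trans hV, Real.pi_gt_three]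
  have hVcos : 0 ≤ Real.cos V.im := Real.cos_nonneg_of_mem_Icc (abs_le.1 hVim)
  have hconc := cos_rpow_mul_cos_rpow_le hγ0.le hγ1 (a := -(arg β / γ)) (b := V.im)
    (by rw [abs_neg]; exact (abs_arg_div_lt hγ0 hβ).le) hVim
  have harg : γ * -(arg β / γ) + (1 - γ) * V.im = (1 - γ) * V.im - arg β := by
    field_simp
    ring
  rw [Real.cos_neg, harg] at hconc
  rw [re_exp_div, Complex.re_ofReal_mul, Complex.im_ofReal_mul]
  refine mul_le_mul_of_nonneg_left ?_ (inv_nonneg.2 (norm_nonneg β))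
  calc Real.cos (arg β / γ) ^ γ * (1 / 2) ^ (1 - γ)
      ≤ Real.cos (arg β / γ) ^ γ * (Real.exp V.re * Real.cos V.im) ^ (1 - γ) := by
        have hcos := Real.cos_nonneg_of_mem_Icc (abs_le.1 (abs_arg_div_lt hγ0 hβ).le)
        have h1γ : 0 ≤ 1 - γ := sub_nonneg.2 hγ1
        gcongr
        exact half_le_exp_re_mul_cos_im hV
    _ = Real.exp ((1 - γ) * V.re) * (Real.cos (arg β / γ) ^ γ * Real.cos V.im ^ (1 - γ)) := by
        rw [Real.mul_rpow (Real.exp_pos _).le hVcos, ← Real.exp_mul, mul_comm V.re]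
        ring
    _ ≤ Real.exp ((1 - γ) * V.re) * Real.cos ((1 - γ) * V.im - arg β) :=
        mul_le_mul_of_nonneg_left hconc (Real.exp_pos _).le

theorem re_cpow_rpow_div_eq (hβ0 : β ≠ 0) (hγ : 0 < γ) (hβ : |arg β| < Real.pi * γ / 2) :
    (β ^ ((1 / γ : ℝ) : ℂ)).re ^ γ / (2 ^ (1 - γ) * ‖β‖ ^ 2) =
      ‖β‖⁻¹ * (Real.cos (arg β / γ) ^ γ * (1 / 2) ^ (1 - γ)) := by
  have hn : 0 < ‖β‖ := norm_pos_iff.2 hβ0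
  have hcos := Real.cos_nonneg_of_mem_Icc (abs_le.1 (abs_arg_div_lt hγ hβ).le)
  rw [Complex.cpow_ofReal_re, mul_one_div, Real.mul_rpow (by positivity) hcos,
    ← Real.rpow_mul hn.le, one_div_mul_cancel hγ.ne', Real.rpow_one, one_div,
    Real.inv_rpow zero_le_two]
  field_simp

theorem exists_pos_le_re_mul_exp_div (hγ0 : 0 < γ) (hγ1 : γ < 1) (hβ : β ≠ 0)
    (ht : t ∈ sector (arg β) (Real.pi * γ / 2)) :
    ∃ ε : ℝ, 0 < ε ∧ ∀ W : ℂ, ‖W‖ ≤ (1 - γ) / 2 → ε ≤ (t * (exp W / β)).re := by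
  obtain ⟨ht0, hta⟩ := ht
  set θ := |arg t - arg β| + (1 - γ) / 2 with hθ
  have hθ0 : 0 ≤ θ := add_nonneg (abs_nonneg _) (by linarith)
  have hθ1 : θ < Real.pi / 2 := by nlinarith [Real.pi_gt_three]
  have hcos : 0 < Real.cos θ := Real.cos_pos_of_mem_Ioo ⟨by linarith [Real.pi_pos], hθ1⟩
  have hn : 0 < ‖t‖ / ‖β‖ := div_pos (norm_pos_iff.2 ht0) (norm_pos_iff.2 hβ)
  refine ⟨‖t‖ / ‖β‖ * (Real.exp (-((1 - γ) / 2)) * Real.cos θ), by positivity, fun W hW => ?_⟩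
  have hWre : -((1 - γ) / 2) ≤ W.re := (abs_le.1 ((abs_re_le_norm W).trans hW)).1
  have hangle : |W.im + (arg t - arg β)| ≤ θ := by
    linarith [abs_add_le W.im (arg t - arg β), (abs_im_le_norm W).trans hW]
  have hcosle : Real.cos θ ≤ Real.cos (W.im + (arg t - arg β)) := by
    rw [← Real.cos_abs (W.im + _)]
    exact Real.cos_le_cos_of_nonneg_of_le_pi (abs_nonneg _) (by linarith [Real.pi_pos]) hangle
  rw [re_mul_exp_div]
  gcongr

theorem exists_pos_le_norm_exp_div (hβ : β ≠ 0) (c : ℝ) :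
    ∃ δ : ℝ, 0 < δ ∧ ∀ W : ℂ, ‖W‖ ≤ c → δ ≤ ‖exp W / β‖ := by
  refine ⟨Real.exp (-c) / ‖β‖, div_pos (Real.exp_pos _) (norm_pos_iff.2 hβ), fun W hW => ?_⟩
  rw [norm_div, norm_exp]
  have hWre : -c ≤ W.re := (abs_le.1 ((abs_re_le_norm W).trans hW)).1
  gcongr

end ExpBounds

section Resolvent

theorem one_lt_re_of_mem_classA {F : ℂ → ℂ} {β : ℂ} {s : ℝ} (hs : 0 < s) (hβ : β.re = 1 + s)
    (hF : F ∈ classA ((2 * s : ℝ) : ℂ) β) {w : ℂ} (hw : w ∈ unitDisk) :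
    1 < (dslope F 0 w).re := by
  obtain ⟨-, hF0, hF', hre⟩ := hF
  rcases eq_or_ne w 0 with rfl | hw0
  · rw [dslope_same, hF', hβ]
    linarith
  have hquot : (1 / ((2 * s : ℝ) : ℂ) * (F w / w - β)).re = ((F w / w).re - (1 + s)) / (2 * s) := by
    rw [one_div_mul_eq_div, div_ofReal_re, sub_re, hβ]
  have h := hre w hw hw0
  rw [hquot, lt_div_iff₀ (by positivity)] at h
  rw [dslope_of_ne _ hw0, slope_def_field, hF0, sub_zero, sub_zero]
  linarith

theorem eqOn_dslope_zero_of_eqOn_mul {f p : ℂ → ℂ} {s : Set ℂ} (hs : s ∈ 𝓝 (0 : ℂ))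
    (hp : DifferentiableAt ℂ p 0) (hf : EqOn f (fun z => z * p z) s) : EqOn (dslope f 0) p s := by
  intro z hz
  rcases eq_or_ne z 0 with rfl | hz0
  · have hderiv := ((hasDerivAt_id' (0 : ℂ)).mul hp.hasDerivAt).congr_of_eventuallyEq
      (hf.eventuallyEq_of_mem hs)
    simpa using hderiv.deriv
  · have hf0 : f 0 = 0 := by simpa using hf (mem_of_mem_nhds hs)
    rw [dslope_of_ne _ hz0, slope_def_field, hf0, sub_zero, sub_zero, hf hz,
      mul_div_cancel_left₀ _ hz0]

theorem sq_norm_inv_le_re_inv {a : ℂ} (ha : 1 ≤ a.re) : ‖a⁻¹‖ ^ 2 ≤ (a⁻¹).re := by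
  rw [inv_re, norm_inv, inv_pow, Complex.sq_norm, inv_eq_one_div]
  exact div_le_div_of_nonneg_right ha (normSq_nonneg a)

variable {q : ℂ} {r : ℝ} {G : ℂ → ℂ}

theorem exists_eqOn_dslope_inv_of_mem_resolventFamily (hs : 0 < r * q.re)
    (hG : G ∈ resolventFamily q r) :
    ∃ Q : ℂ → ℂ, DifferentiableOn ℂ Q unitDisk ∧ Q 0 = 1 + r * q ∧ (∀ w ∈ unitDisk, 1 < (Q w).re) ∧
      (∀ z ∈ unitDisk, G z * Q (G z) = z) ∧ EqOn (dslope G 0) (fun z => (Q (G z))⁻¹) unitDisk := by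
  obtain ⟨hGd, hGm, F, hF, hFG⟩ := hG
  have hQd : DifferentiableOn ℂ (dslope F 0) unitDisk :=
    (differentiableOn_dslope (unitDisk_mem_nhds zero_mem_unitDisk)).2 hF.1
  have hQre : ∀ w ∈ unitDisk, 1 < (dslope F 0 w).re := fun w hw =>
    one_lt_re_of_mem_classA (β := 1 + r * q) hs (by rw [add_re, one_re, Complex.re_ofReal_mul])
      (by rwa [← mul_assoc]) hw
  have hQne : ∀ w ∈ unitDisk, dslope F 0 w ≠ 0 := fun w hw h0 =>
    (zero_lt_one.trans (hQre w hw)).ne' (by rw [h0, zero_re])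
  have hGQ : ∀ z ∈ unitDisk, G z * dslope F 0 (G z) = z := fun z hz => by
    have hFQ := sub_smul_dslope F 0 (G z)
    rwa [hF.2.1, sub_zero, sub_zero, smul_eq_mul, hFG z hz] at hFQ
  refine ⟨dslope F 0, hQd, (dslope_same F 0).trans hF.2.2.1, hQre, hGQ,
    eqOn_dslope_zero_of_eqOn_mul (unitDisk_mem_nhds zero_mem_unitDisk) ?_ fun z hz =>
      (eq_mul_inv_iff_mul_eq₀ (hQne _ (hGm hz))).2 (hGQ z hz)⟩
  exact ((hQd.comp hGd hGm).inv fun z hz => hQne _ (hGm hz)).differentiableAt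
    (unitDisk_mem_nhds zero_mem_unitDisk)

theorem exists_eq_mul_of_mem_resolventFamily (hs : 6 ≤ r * q.re) (hG : G ∈ resolventFamily q r) :
    ∃ g : ℂ → ℂ, G = (fun z => z * g z) ∧ DifferentiableOn ℂ g unitDisk ∧
      (∀ z ∈ unitDisk, ‖g z‖ ^ 2 ≤ (g z).re) ∧
      ∀ z ∈ unitDisk, ∃ W : ℂ, ‖W‖ ≤ (1 - gammaR q r) / 2 ∧ g z = exp W / (1 + r * q) := by
  obtain ⟨Q, hQd, hQ0, hQre, hGQ, hg⟩ :=
    exists_eqOn_dslope_inv_of_mem_resolventFamily (by linarith) hG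
  obtain ⟨hGd, hGm, -⟩ := hG
  have hQne : Q (G 0) ≠ 0 := fun h0 =>
    (zero_lt_one.trans (hQre _ (hGm zero_mem_unitDisk))).ne' (by rw [h0, zero_re])
  have hG0 : G 0 = 0 := (mul_eq_zero.1 (hGQ 0 zero_mem_unitDisk)).resolve_right hQne
  refine ⟨dslope G 0, funext fun z => ?_,
    (differentiableOn_dslope (unitDisk_mem_nhds zero_mem_unitDisk)).2 hGd, fun z hz => ?_,
    fun z hz => ?_⟩
  · simpa [hG0] using (sub_smul_dslope G 0 z).symm
  · rw [hg hz]
    exact sq_norm_inv_le_re_inv (hQre _ (hGm hz)).le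
  · obtain ⟨W, hW, hWinv⟩ := exists_inv_eq_exp_div hQd hQre (hGm hz)
    have hGz := norm_mul_re_sub_two_lt_one hQd hQre (hGm hz)
      (by simpa [hGQ z hz] using mem_unitDisk.1 hz)
    have hQ0re : (Q 0).re - 2 = r * q.re - 1 := by
      rw [hQ0, add_re, one_re, Complex.re_ofReal_mul]
      ring
    refine ⟨W, hW.trans (log_bound_le_one_sub_gammaR_div_two hs (norm_nonneg _) ?_), ?_⟩
    · rwa [← hQ0re]
    · exact (hg hz).trans (hQ0 ▸ hWinv)

theorem one_add_mul_ne_zero (hs : 0 ≤ r * q.re) : (1 + r * q : ℂ) ≠ 0 := fun h => by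
  have hre := congrArg Complex.re h
  rw [add_re, one_re, Complex.re_ofReal_mul, zero_re] at hre
  linarith

theorem kappaR_eq (hs : 6 ≤ r * q.re) (harg : |arg (1 + r * q)| < Real.pi * gammaR q r / 2) :
    kappaR q r = ‖1 + r * q‖⁻¹ *
      (Real.cos (arg (1 + r * q) / gammaR q r) ^ gammaR q r * (1 / 2) ^ (1 - gammaR q r)) :=
  re_cpow_rpow_div_eq (one_add_mul_ne_zero (by linarith)) (gammaR_mem_Ioo hs).1 harg

theorem kappaR_pos (hs : 6 ≤ r * q.re) (harg : |arg (1 + r * q)| < Real.pi * gammaR q r / 2) :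
    0 < kappaR q r := by
  have hβ := norm_pos_iff.2 (one_add_mul_ne_zero (by linarith : 0 ≤ r * q.re))
  have hcos := Real.cos_pos_of_mem_Ioo (abs_lt.1 (abs_arg_div_lt (gammaR_mem_Ioo hs).1 harg))
  rw [kappaR_eq hs harg]
  positivity

theorem kappaR_le_re_exp_div (hs : 6 ≤ r * q.re)
    (harg : |arg (1 + r * q)| < Real.pi * gammaR q r / 2) {W : ℂ}
    (hW : ‖W‖ ≤ (1 - gammaR q r) / 2) : kappaR q r ≤ (exp W / (1 + r * q)).re := by
  obtain ⟨hγ0, hγ1⟩ := gammaR_mem_Ioo hs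
  have h1γ : 0 < 1 - gammaR q r := sub_pos.2 hγ1
  have hV : ‖W / (1 - gammaR q r : ℝ)‖ ≤ 1 / 2 := by
    rw [norm_div, norm_real, Real.norm_of_nonneg h1γ.le, div_le_iff₀ h1γ]
    linarith
  have hle := cos_arg_div_rpow_mul_le_re_exp_div hγ0 hγ1.le harg hV
  rwa [mul_div_cancel₀ W (ofReal_ne_zero.2 h1γ.ne'), ← kappaR_eq hs harg] at hle

theorem norm_le_one_of_sq_norm_le_re {a : ℂ} (ha : ‖a‖ ^ 2 ≤ a.re) : ‖a‖ ≤ 1 := by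
  by_contra! h
  nlinarith [re_le_norm a]

theorem exists_pos_le_re_of_sq_norm_le_re {g : ℂ → ℂ} {β : ℂ} {c : ℝ} (hβ : β ≠ 0)
    (hsq : ∀ z ∈ unitDisk, ‖g z‖ ^ 2 ≤ (g z).re)
    (hexp : ∀ z ∈ unitDisk, ∃ W : ℂ, ‖W‖ ≤ c ∧ g z = exp W / β) :
    ∃ δ : ℝ, 0 < δ ∧ ∀ z ∈ unitDisk, δ ≤ (g z).re := by
  obtain ⟨δ, hδ0, hδ⟩ := exists_pos_le_norm_exp_div hβ c
  refine ⟨δ ^ 2, by positivity, fun z hz => le_trans ?_ (hsq z hz)⟩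
  obtain ⟨W, hW, hgz⟩ := hexp z hz
  exact pow_le_pow_left₀ hδ0.le (hgz ▸ hδ W hW) 2

end Resolvent

theorem mainTheorem4 (q : ℂ) (hq : 0 < q.re) (r : ℝ) (hr : 6 / q.re ≤ r)
    (G : ℂ → ℂ) (hG : G ∈ resolventFamily q r) :
    IsGenerator G ∧
    ∀ u : ℝ → ℂ → ℂ, IsSemigroupGeneratedBy G u →
      (TendstoUniformlyOn u (fun _ => 0) atTop unitDisk ∧
        (|arg (1 + r * q)| < Real.pi * gammaR q r / 2 →
          IsSqueezingCoefficient u (kappaR q r))) ∧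
      (∀ z ∈ unitDisk, ExtendsAnalyticallyTo (fun t => u t z)
        (sector (arg (1 + r * q)) (Real.pi * gammaR q r / 2))) := by
  have hs : 6 ≤ r * q.re := (div_le_iff₀ hq).1 hr
  have hβ : (1 + r * q : ℂ) ≠ 0 := one_add_mul_ne_zero (by linarith)
  obtain ⟨hγ0, hγ1⟩ := gammaR_mem_Ioo hs
  obtain ⟨g, rfl, hgd, hsq, hexp⟩ := exists_eq_mul_of_mem_resolventFamily hs hG
  obtain ⟨δ, hδ0, hδ⟩ := exists_pos_le_re_of_sq_norm_le_re hβ hsq hexp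
  have hre : ∀ z ∈ unitDisk, 0 < (g z).re := fun z hz => hδ0.trans_le (hδ z hz)
  have hg1 : ∀ z ∈ unitDisk, ‖g z‖ ≤ 1 := fun z hz => norm_le_one_of_sq_norm_le_re (hsq z hz)
  refine ⟨isGenerator_mul_of_re_pos hgd hre, fun u hu =>
    ⟨⟨(isSqueezingCoefficient_of_le_re hδ0 hδ hu).tendstoUniformlyOn, fun harg =>
      isSqueezingCoefficient_of_le_re (kappaR_pos hs harg) (fun z hz => ?_) hu⟩,
    fun z hz => (hu z hz).extendsAnalyticallyTo hz hgd hre (fun t ht => ?_) fun t ht => ?_⟩⟩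
  · obtain ⟨W, hW, hgz⟩ := hexp z hz
    exact hgz ▸ kappaR_le_re_exp_div hs harg hW
  · refine mem_interior_accretiveTimes hg1 (mul_pos ht hδ0) fun w hw => ?_
    rw [Complex.re_ofReal_mul]
    exact mul_le_mul_of_nonneg_left (hδ w hw) ht.le
  · obtain ⟨ε, hε0, hε⟩ := exists_pos_le_re_mul_exp_div hγ0 hγ1 hβ ht
    refine mem_interior_accretiveTimes hg1 hε0 fun w hw => ?_
    obtain ⟨W, hW, hgw⟩ := hexp w hw
    exact hgw ▸ hε W hW
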